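/- Let $\Lambda$ be a finite-dimensional algebra over an algebraically closed field $k$, let $\operatorname{mod}\Lambda$ be the category of finitely generated $\Lambda$-modules, and let $K_0(\operatorname{proj}\Lambda)$ be the Grothendieck group of the category of finitely generated projective $\Lambda$-modules; its elements are called g-vectors. For $M\in\operatorname{mod}\Lambda$ let $\langle -,[M]\rangle\colon K_0(\operatorname{proj}\Lambda)\to\mathbb{Z}$ be the homomorphism with $\langle [P],[M]\rangle=\dim_k\operatorname{Hom}_\Lambda(P,M)$. For a g-vector $h$ set \[ \overline{\mathcal T}_h=\{M\in\operatorname{mod}\Lambda \mid \langle h,[M']\rangle\ge 0 \text{ for every factor module } M' \text{ of } M\}, \] \[ \overline{\mathcal F}_h=\{M\in\operatorname{mod}\Lambda \mid \langle h,[M']\rangle\le 0 \text{ for every submodule } M' \text{ of } M\}. \] For a g-vector $g$ let $\operatorname{TF}^{\mathrm{ss}}_{\mathbb Z}(g)$ be the set of all pairs $(\overline{\mathcal T}_h,\overline{\mathcal F}_h)$, with $h$ a g-vector, such that $\overline{\mathcal T}_g\subseteq\overline{\mathcal T}_h$ and $\overline{\mathcal F}_g\subseteq\overline{\mathcal F}_h$,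 and let \[ \operatorname{TF}^{\mathrm{ss}}_{\mathbb Z}(\Lambda)=\bigcup_{g\in K_0(\operatorname{proj}\Lambda)}\operatorname{TF}^{\mathrm{ss}}_{\mathbb Z}(g), \] partially ordered by componentwise inclusion. Then every non-empty subset of $\operatorname{TF}^{\mathrm{ss}}_{\mathbb Z}(\Lambda)$ has a minimal element. -/

import Mathlib

universe u v

/-! ### Dimensions of spaces of homomorphisms -/

section HomDim

variable (k : Type u) [Field k] {Λ : Type v} [Ring Λ] [Algebra k Λ]

/-- `dim_k Hom_Λ(P, M)` for left modules over a `k`-algebra `Λ`; the `k`-vector space structure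
is the one induced by `k → Λ`. -/
noncomputable def homDim (P M : Type v) [AddCommGroup P] [Module Λ P]
    [AddCommGroup M] [Module Λ M] : ℕ :=
  letI : Module k M := Module.restrictScalars k Λ M
  haveI : IsScalarTower k Λ M := IsScalarTower.restrictScalars k Λ M
  haveI : SMulCommClass Λ k M := IsScalarTower.to_smulCommClass'
  Module.finrank k (P →ₗ[Λ] M)

theorem finite_hom_of_finite [Module.Finite k Λ] (P M : Type v) [AddCommGroup P] [Module Λ P]
    [AddCommGroup M] [Module Λ M] [Module.Finite Λ P] [Module.Finite Λ M]
    [Module k M] [IsScalarTower k Λ M] [SMulCommClass Λ k M] :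
    Module.Finite k (P →ₗ[Λ] M) := by
  let _ : Module k P := Module.restrictScalars k Λ P
  have : IsScalarTower k Λ P := IsScalarTower.restrictScalars k Λ P
  have : Module.Finite k P := Module.Finite.trans Λ P
  have : Module.Finite k M := Module.Finite.trans Λ M
  let f : (P →ₗ[Λ] M) →ₗ[k] (P →ₗ[k] M) :=
    { toFun := fun φ => φ.restrictScalars k
      map_add' := fun _ _ => rfl
      map_smul' := fun _ _ => rfl }
  exact Module.Finite.of_injective f (LinearMap.restrictScalars_injective k)

/-- `dim_k Hom_Λ(-, M)` is additive on direct sums of finitely generated modules. -/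
theorem homDim_of_equiv_prod [Module.Finite k Λ] {P P₁ P₂ : Type v} (M : Type v)
    [AddCommGroup P] [Module Λ P] [AddCommGroup P₁] [Module Λ P₁] [AddCommGroup P₂] [Module Λ P₂]
    [AddCommGroup M] [Module Λ M] [Module.Finite Λ P₁] [Module.Finite Λ P₂] [Module.Finite Λ M]
    (e : P ≃ₗ[Λ] P₁ × P₂) :
    homDim (Λ := Λ) k P M = homDim (Λ := Λ) k P₁ M + homDim (Λ := Λ) k P₂ M := by
  let _ : Module k M := Module.restrictScalars k Λ M
  have : IsScalarTower k Λ M := IsScalarTower.restrictScalars k Λ M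
  have : SMulCommClass Λ k M := IsScalarTower.to_smulCommClass'
  have := finite_hom_of_finite (Λ := Λ) k P₁ M
  have := finite_hom_of_finite (Λ := Λ) k P₂ M
  let f : (P →ₗ[Λ] M) ≃ₗ[k] (P₁ →ₗ[Λ] M) × (P₂ →ₗ[Λ] M) :=
    { toFun := fun φ => (φ ∘ₗ e.symm.toLinearMap ∘ₗ LinearMap.inl Λ P₁ P₂,
        φ ∘ₗ e.symm.toLinearMap ∘ₗ LinearMap.inr Λ P₁ P₂)
      map_add' := fun _ _ => rfl
      map_smul' := fun _ _ => rfl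
      invFun := fun p => (p.1.coprod p.2) ∘ₗ e.toLinearMap
      left_inv := fun φ => by
        ext x
        simp [← map_add]
      right_inv := fun p => by
        ext x <;> simp }
  exact f.finrank_eq.trans (Module.finrank_prod)

end HomDim

/-! ### The Grothendieck group of finitely generated projective modules -/

section KZero

variable (Λ : Type v) [Ring Λ]

/-- Finitely generated projective (left) `Λ`-modules. -/
abbrev FGProj : Type (v + 1) := {P : FGModuleCat.{v} Λ // Module.Projective Λ P}

/-- The subgroup generated by the relations `[P] - [P₁] - [P₂]` with `P ≅ P₁ ⊕ P₂`. -/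
def kZeroRelations : AddSubgroup (FreeAbelianGroup (FGProj Λ)) :=
  AddSubgroup.closure
    {x | ∃ P P₁ P₂ : FGProj Λ, Nonempty (P.1 ≃ₗ[Λ] P₁.1 × P₂.1) ∧
      x = FreeAbelianGroup.of P - FreeAbelianGroup.of P₁ - FreeAbelianGroup.of P₂}

/-- `K₀(proj Λ)`; its elements are the g-vectors. -/
abbrev KZeroProj : Type (v + 1) := FreeAbelianGroup (FGProj Λ) ⧸ kZeroRelations Λ

end KZero

/-! ### The Euler pairing and the semistable torsion and torsion-free classes -/

section Semistable

variable (k : Type u) [Field k] {Λ : Type v} [Ring Λ] [Algebra k Λ] [Module.Finite k Λ]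

/-- `⟨-, [M]⟩ : K₀(proj Λ) → ℤ`, determined by `⟨[P], [M]⟩ = dim_k Hom_Λ(P, M)`. -/
noncomputable def eulerPairing (M : Type v) [AddCommGroup M] [Module Λ M] [Module.Finite Λ M] :
    KZeroProj Λ →+ ℤ :=
  QuotientAddGroup.lift (kZeroRelations Λ)
    (FreeAbelianGroup.lift fun P : FGProj Λ => (homDim (Λ := Λ) k P.1 M : ℤ)) <| by
      rw [kZeroRelations, AddSubgroup.closure_le]
      rintro x ⟨P, P₁, P₂, ⟨e⟩, rfl⟩
      simp only [SetLike.mem_coe, AddMonoidHom.mem_ker, map_sub, FreeAbelianGroup.lift_apply_of]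
      rw [homDim_of_equiv_prod k M e]
      push_cast
      ring

/-- `T̄_g`: the modules all of whose factor modules pair non-negatively with `g`. -/
def torsBar (g : KZeroProj Λ) : Set (FGModuleCat.{v} Λ) :=
  {M | ∀ N : Submodule Λ M, 0 ≤ eulerPairing k (M ⧸ N) g}

/-- `F̄_g`: the modules all of whose submodules pair non-positively with `g`. -/
def torfBar (g : KZeroProj Λ) : Set (FGModuleCat.{v} Λ) :=
  haveI : IsNoetherianRing Λ := isNoetherian_of_tower k inferInstance
  {M | ∀ N : Submodule Λ M, eulerPairing k N g ≤ 0}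

/-- The pair `(T̄_g, F̄_g)`. Pairs are ordered by componentwise inclusion. -/
def ssPair (g : KZeroProj Λ) : Set (FGModuleCat.{v} Λ) × Set (FGModuleCat.{v} Λ) :=
  (torsBar k g, torfBar k g)

/-- `TF^ss_ℤ(g)`. -/
def TFssAt (g : KZeroProj Λ) : Set (Set (FGModuleCat.{v} Λ) × Set (FGModuleCat.{v} Λ)) :=
  {p | ∃ h : KZeroProj Λ, p = ssPair k h ∧
    torsBar k g ⊆ torsBar k h ∧ torfBar k g ⊆ torfBar k h}

variable (Λ) in
/-- `TF^ss_ℤ(Λ)`, the union of all `TF^ss_ℤ(g)`. -/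
def TFss : Set (Set (FGModuleCat.{v} Λ) × Set (FGModuleCat.{v} Λ)) :=
  ⋃ g : KZeroProj Λ, TFssAt k g

end Semistable

/-! To a g-vector `g` belongs the cone `ssCone k g` of all `h` whose pair contains that of `g`;
smaller pairs have larger cones. Pairings depend only on values on finitely many modules, so these
cones live in a finite-dimensional rational space, and some pair in `S` has a cone whose span has
maximal dimension. That pair is minimal. Indeed, if the pair of `h` in `S` lies below that of `g`,
both cones have the same span, so some positive multiple `n • h` equals `a - b` with `a`, `b` in the
cone of `g`, up to g-vectors pairing to zero with everything. Thus `g + a` agrees with `n • h + (g +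
b)`, where `g + b` also lies in the cone of `h`. The key fact `ssPair_le_of_eulerPairing` says that
adding such an element to a positive multiple of `h` cannot give a pair larger than that of `h`.
Hence the pair of `g` lies below that of `g + a`, which lies below that of `h`. -/

open Module

/-! ### Exactness of Hom from a projective module -/

section HomDim

variable (k : Type u) [Field k] {Λ : Type v} [Ring Λ] [Algebra k Λ] [Module.Finite k Λ]

/-- `dim_k Hom_Λ(P, -)` is additive on short exact sequences when `P` is projective. -/
theorem homDim_of_exact {P A B C : Type v} [AddCommGroup P] [Module Λ P] [Module.Finite Λ P]
    [Module.Projective Λ P] [AddCommGroup A] [Module Λ A]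
    [AddCommGroup B] [Module Λ B] [Module.Finite Λ B] [AddCommGroup C] [Module Λ C]
    (f : A →ₗ[Λ] B) (g : B →ₗ[Λ] C) (hf : Function.Injective f) (hg : Function.Surjective g)
    (h : Function.Exact f g) :
    homDim (Λ := Λ) k P B = homDim (Λ := Λ) k P A + homDim (Λ := Λ) k P C := by
  let _ : Module k A := Module.restrictScalars k Λ A
  have : IsScalarTower k Λ A := IsScalarTower.restrictScalars k Λ A
  have : SMulCommClass Λ k A := IsScalarTower.to_smulCommClass'
  let _ : Module k B := Module.restrictScalars k Λ B
  have : IsScalarTower k Λ B := IsScalarTower.restrictScalars k Λ B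
  have : SMulCommClass Λ k B := IsScalarTower.to_smulCommClass'
  let _ : Module k C := Module.restrictScalars k Λ C
  have : IsScalarTower k Λ C := IsScalarTower.restrictScalars k Λ C
  have : SMulCommClass Λ k C := IsScalarTower.to_smulCommClass'
  have := finite_hom_of_finite (Λ := Λ) k P B
  let F : (P →ₗ[Λ] A) →ₗ[k] (P →ₗ[Λ] B) :=
    { toFun := fun φ => f ∘ₗ φ
      map_add' := fun φ ψ => by ext; simp
      map_smul' := fun c φ => by ext; simp [LinearMap.map_smul_of_tower] }
  let G : (P →ₗ[Λ] B) →ₗ[k] (P →ₗ[Λ] C) :=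
    { toFun := fun φ => g ∘ₗ φ
      map_add' := fun φ ψ => by ext; simp
      map_smul' := fun c φ => by ext; simp [LinearMap.map_smul_of_tower] }
  have hF : Function.Injective F := fun φ ψ e => by
    ext x
    exact hf (LinearMap.congr_fun e x)
  have hG : Function.Surjective G := fun φ => Module.projective_lifting_property g φ hg
  have hFG : LinearMap.ker G = LinearMap.range F := by
    ext φ
    constructor
    · intro hφ
      have hφ' : ∀ x, φ x ∈ LinearMap.range f := fun x =>
        (h (φ x)).1 (LinearMap.congr_fun (LinearMap.mem_ker.1 hφ) x)
      obtain ⟨ψ, hψ⟩ := Module.projective_lifting_property f.rangeRestrict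
        (φ.codRestrict _ hφ') f.surjective_rangeRestrict
      refine ⟨ψ, ?_⟩
      ext x
      exact congrArg Subtype.val (LinearMap.congr_fun hψ x)
    · rintro ⟨ψ, rfl⟩
      ext x
      exact h.apply_apply_eq_zero (ψ x)
  have h1 := G.finrank_range_add_finrank_ker
  rw [LinearMap.range_eq_top.2 hG, finrank_top, hFG, LinearMap.finrank_range_of_inj hF] at h1
  exact h1.symm.trans (add_comm _ _)

end HomDim

/-! ### Additivity of the pairing and submodules that maximize it -/

section EulerPairing

variable (k : Type u) [Field k] {Λ : Type v} [Ring Λ] [Algebra k Λ] [Module.Finite k Λ]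

theorem KZeroProj.induction {p : KZeroProj Λ → Prop}
    (of : ∀ P : FGProj Λ, p (QuotientAddGroup.mk (FreeAbelianGroup.of P)))
    (zero : p 0) (neg : ∀ x, p x → p (-x)) (add : ∀ x y, p x → p y → p (x + y))
    (x : KZeroProj Λ) : p x := by
  obtain ⟨x, rfl⟩ := QuotientAddGroup.mk_surjective x
  induction x using FreeAbelianGroup.induction_on with
  | zero => exact zero
  | of P => exact of P
  | neg P h => exact neg _ h
  | add x y hx hy => exact add _ _ hx hy

theorem eulerPairing_of (M : Type v) [AddCommGroup M] [Module Λ M] [Module.Finite Λ M]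
    (P : FGProj Λ) :
    eulerPairing k M (QuotientAddGroup.mk (FreeAbelianGroup.of P)) =
      (homDim (Λ := Λ) k P.1 M : ℤ) :=
  FreeAbelianGroup.lift_apply_of _ _

theorem eulerPairing_of_exact {A B C : Type v} [AddCommGroup A] [Module Λ A] [Module.Finite Λ A]
    [AddCommGroup B] [Module Λ B] [Module.Finite Λ B]
    [AddCommGroup C] [Module Λ C] [Module.Finite Λ C]
    (f : A →ₗ[Λ] B) (g : B →ₗ[Λ] C) (hf : Function.Injective f) (hg : Function.Surjective g)
    (h : Function.Exact f g) (x : KZeroProj Λ) :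
    eulerPairing k B x = eulerPairing k A x + eulerPairing k C x := by
  induction x using KZeroProj.induction with
  | of P =>
    have := P.2
    simp only [eulerPairing_of]
    exact_mod_cast homDim_of_exact k f g hf hg h
  | zero => simp
  | neg x hx => simp only [map_neg, hx]; ring
  | add x y hx hy => simp only [map_add, hx, hy]; ring

theorem eulerPairing_of_subsingleton (M : Type v) [AddCommGroup M] [Module Λ M]
    [Module.Finite Λ M] [Subsingleton M] (x : KZeroProj Λ) : eulerPairing k M x = 0 := by
  -- Additivity on the sequence of zero modules reads `v = v + v`.
  have := eulerPairing_of_exact k (0 : M →ₗ[Λ] M) (0 : M →ₗ[Λ] M)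
    (Function.injective_of_subsingleton _) (fun y => ⟨0, Subsingleton.elim _ _⟩)
    (fun y => ⟨fun _ => ⟨0, Subsingleton.elim _ _⟩, fun _ => rfl⟩) x
  linarith

theorem eulerPairing_congr {M N : Type v} [AddCommGroup M] [Module Λ M] [Module.Finite Λ M]
    [AddCommGroup N] [Module Λ N] [Module.Finite Λ N] (e : M ≃ₗ[Λ] N) (x : KZeroProj Λ) :
    eulerPairing k M x = eulerPairing k N x := by
  rw [eulerPairing_of_exact k (0 : PUnit.{v + 1} →ₗ[Λ] M) e.toLinearMap
    (Function.injective_of_subsingleton _) e.surjective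
    (fun y => ⟨fun h => ⟨0, (e.map_eq_zero_iff.1 h).symm⟩, by rintro ⟨_, rfl⟩; simp⟩) x,
    eulerPairing_of_subsingleton, zero_add]

variable [IsNoetherianRing Λ] {M : Type v} [AddCommGroup M] [Module Λ M] [Module.Finite Λ M]

theorem eulerPairing_submodule_add_quotient (N : Submodule Λ M) (x : KZeroProj Λ) :
    eulerPairing k N x + eulerPairing k (M ⧸ N) x = eulerPairing k M x :=
  (eulerPairing_of_exact k N.subtype N.mkQ N.injective_subtype N.mkQ_surjective
    (LinearMap.exact_subtype_mkQ N) x).symm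

theorem eulerPairing_comap_mkQ (N : Submodule Λ M) (L : Submodule Λ (M ⧸ N)) (x : KZeroProj Λ) :
    eulerPairing k (L.comap N.mkQ) x = eulerPairing k N x + eulerPairing k L x := by
  have hN : N ≤ L.comap N.mkQ := by
    intro y hy
    simp [(Submodule.Quotient.mk_eq_zero N).2 hy]
  refine eulerPairing_of_exact k (Submodule.inclusion hN)
    (N.mkQ.restrict (p := L.comap N.mkQ) (q := L) fun _ hy => hy)
    (Submodule.inclusion_injective hN) ?_ ?_ x
  · rintro ⟨y, hy⟩
    obtain ⟨y, rfl⟩ := N.mkQ_surjective y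
    exact ⟨⟨y, hy⟩, rfl⟩
  · rintro ⟨y, hy⟩
    rw [← Subtype.coe_inj]
    change Submodule.Quotient.mk y = 0 ↔ _
    rw [Submodule.Quotient.mk_eq_zero]
    exact ⟨fun h => ⟨⟨y, h⟩, rfl⟩, by
      rintro ⟨z, hz⟩
      have hzy : (z : M) = y := congrArg Subtype.val hz
      exact hzy ▸ z.2⟩

theorem eulerPairing_map_subtype (N : Submodule Λ M) (L : Submodule Λ N) (x : KZeroProj Λ) :
    eulerPairing k (L.map N.subtype) x = eulerPairing k L x :=
  (eulerPairing_congr k (L.equivMapOfInjective _ N.injective_subtype) x).symm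

variable (M) in
/-- The pairings of a fixed g-vector with the submodules of a fixed module are bounded. -/
theorem exists_eulerPairing_submodule_le (x : KZeroProj Λ) :
    ∃ b : ℤ, ∀ N : Submodule Λ M, |eulerPairing k N x| ≤ b := by
  induction x using KZeroProj.induction with
  | of P =>
    -- On the class of a projective the pairing is a dimension, so it is non-negative and, by
    -- additivity, grows with the submodule.
    refine ⟨eulerPairing k M (QuotientAddGroup.mk (FreeAbelianGroup.of P)), fun N => ?_⟩
    rw [← eulerPairing_submodule_add_quotient k N]
    simp only [eulerPairing_of]
    rw [abs_of_nonneg (by positivity)]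
    simp
  | zero => exact ⟨0, fun N => by simp⟩
  | neg x hx => simpa using hx
  | add x y hx hy =>
    obtain ⟨b, hb⟩ := hx
    obtain ⟨c, hc⟩ := hy
    refine ⟨b + c, fun N => ?_⟩
    rw [map_add]
    exact (abs_add_le _ _).trans (add_le_add (hb N) (hc N))

variable (M) in
theorem exists_eulerPairing_submodule_max (x : KZeroProj Λ) :
    ∃ N : Submodule Λ M, ∀ L : Submodule Λ M, eulerPairing k L x ≤ eulerPairing k N x := by
  obtain ⟨b, hb⟩ := exists_eulerPairing_submodule_le k M x
  obtain ⟨_, ⟨N, rfl⟩, hN⟩ := Int.exists_greatest_of_bdd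
    (P := fun z => ∃ N : Submodule Λ M, eulerPairing k N x = z)
    ⟨b, by rintro _ ⟨N, rfl⟩; exact (le_abs_self _).trans (hb N)⟩ ⟨_, ⊥, rfl⟩
  exact ⟨N, fun L => hN _ ⟨L, rfl⟩⟩

variable (M) in
/-- The largest submodule on which the pairing with `x` is maximal. -/
theorem exists_eulerPairing_submodule_max_largest (x : KZeroProj Λ) :
    ∃ N : Submodule Λ M, (∀ L : Submodule Λ M, eulerPairing k L x ≤ eulerPairing k N x) ∧
      ∀ L : Submodule Λ M, N < L → eulerPairing k L x < eulerPairing k N x := by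
  obtain ⟨N₀, h₀⟩ := exists_eulerPairing_submodule_max k M x
  obtain ⟨N, hN, hmin⟩ := wellFounded_gt.has_min
    {N : Submodule Λ M | eulerPairing k N x = eulerPairing k N₀ x} ⟨N₀, rfl⟩
  rw [Set.mem_ofPred_eq] at hN
  refine ⟨N, fun L => hN ▸ h₀ L, fun L hL => lt_of_le_of_ne (hN ▸ h₀ L) fun h => ?_⟩
  exact hmin L (h.trans hN) hL

variable (M) in
/-- The smallest submodule on which the pairing with `x` is maximal. -/
theorem exists_eulerPairing_submodule_max_smallest [IsArtinianRing Λ] (x : KZeroProj Λ) :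
    ∃ N : Submodule Λ M, (∀ L : Submodule Λ M, eulerPairing k L x ≤ eulerPairing k N x) ∧
      ∀ L : Submodule Λ M, L < N → eulerPairing k L x < eulerPairing k N x := by
  obtain ⟨N₀, h₀⟩ := exists_eulerPairing_submodule_max k M x
  obtain ⟨N, hN, hmin⟩ := wellFounded_lt.has_min
    {N : Submodule Λ M | eulerPairing k N x = eulerPairing k N₀ x} ⟨N₀, rfl⟩
  rw [Set.mem_ofPred_eq] at hN
  refine ⟨N, fun L => hN ▸ h₀ L, fun L hL => lt_of_le_of_ne (hN ▸ h₀ L) fun h => ?_⟩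
  exact hmin L (h.trans hN) hL

end EulerPairing

/-! ### Finitely many simple modules determine all pairings -/

section Simples

variable (k : Type u) [Field k] {Λ : Type v} [Ring Λ] [Algebra k Λ] [Module.Finite k Λ]

/-- A non-zero map to a simple module either restricts non-trivially to `N` or factors through the
simple quotient `A ⧸ N`, where Schur's lemma makes it an isomorphism. For `A = Λ` this reaches every
simple module. -/
theorem IsFiniteLength.exists_finite_simples {A : Type v} [AddCommGroup A] [Module Λ A]
    (hA : IsFiniteLength Λ A) :
    ∃ s : Set (FGModuleCat.{v} Λ), s.Finite ∧
      ∀ (S : Type v) [AddCommGroup S] [Module Λ S] [IsSimpleModule Λ S] (f : A →ₗ[Λ] S),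
        f ≠ 0 → ∃ T ∈ s, Nonempty (S ≃ₗ[Λ] T) := by
  induction hA with
  | of_subsingleton =>
    exact ⟨∅, Set.finite_empty, fun S _ _ _ f hf => (hf (Subsingleton.elim _ _)).elim⟩
  | @of_simple_quotient A _ _ N _ _ ih =>
    obtain ⟨s, hs, h⟩ := ih
    refine ⟨insert (FGModuleCat.of Λ (A ⧸ N)) s, hs.insert _, fun S _ _ _ f hf => ?_⟩
    by_cases hfN : f ∘ₗ N.subtype = 0
    · have hle : N ≤ LinearMap.ker f := fun y hy => LinearMap.congr_fun hfN ⟨y, hy⟩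
      refine ⟨_, Set.mem_insert _ _, ⟨(LinearEquiv.ofBijective (N.liftQ f hle) ?_).symm⟩⟩
      refine (LinearMap.bijective_or_eq_zero _).resolve_right fun h0 => hf ?_
      rw [← N.liftQ_mkQ f hle, h0, LinearMap.zero_comp]
    · obtain ⟨T, hT, e⟩ := h S _ hfN
      exact ⟨T, Set.mem_insert_of_mem _ hT, e⟩

theorem exists_finite_simples [IsNoetherianRing Λ] [IsArtinianRing Λ] :
    ∃ s : Set (FGModuleCat.{v} Λ), s.Finite ∧
      ∀ (S : Type v) [AddCommGroup S] [Module Λ S] [IsSimpleModule Λ S],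
        ∃ T ∈ s, Nonempty (S ≃ₗ[Λ] T) := by
  obtain ⟨s, hs, h⟩ := IsFiniteLength.exists_finite_simples
    (isFiniteLength_iff_isNoetherian_isArtinian.2 ⟨‹_›, ‹_›⟩ : IsFiniteLength Λ Λ)
  refine ⟨s, hs, fun S _ _ _ => ?_⟩
  have := IsSimpleModule.nontrivial Λ S
  obtain ⟨y, hy⟩ := exists_ne (0 : S)
  refine h S (LinearMap.toSpanSingleton Λ S y) fun h0 => hy ?_
  simpa using LinearMap.congr_fun h0 1

theorem eulerPairing_eq_zero_of_simples [IsNoetherianRing Λ] {x : KZeroProj Λ}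
    (hx : ∀ (S : Type v) [AddCommGroup S] [Module Λ S] [Module.Finite Λ S] [IsSimpleModule Λ S],
      eulerPairing k S x = 0) {M : Type v} [AddCommGroup M] [Module Λ M] (hM : IsFiniteLength Λ M) :
    -- Finiteness stands inside the goal because the induction changes the module.
    ∀ [Module.Finite Λ M], eulerPairing k M x = 0 := by
  induction hM with
  | of_subsingleton => exact eulerPairing_of_subsingleton k _ x
  | @of_simple_quotient A _ _ N _ _ ih =>
    intro _
    rw [← eulerPairing_submodule_add_quotient k N, ih, hx, add_zero]

/-- The pairings with all modules are determined by finitely many of them. -/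
theorem exists_finite_eulerPairing [IsNoetherianRing Λ] [IsArtinianRing Λ] :
    ∃ s : Set (FGModuleCat.{v} Λ), s.Finite ∧ ∀ x y : KZeroProj Λ,
      (∀ T ∈ s, eulerPairing k T x = eulerPairing k T y) →
      ∀ (M : Type v) [AddCommGroup M] [Module Λ M] [Module.Finite Λ M],
        eulerPairing k M x = eulerPairing k M y := by
  obtain ⟨s, hs, h⟩ := exists_finite_simples (Λ := Λ)
  refine ⟨s, hs, fun x y hxy M _ _ _ => ?_⟩
  rw [← sub_eq_zero, ← map_sub]
  refine eulerPairing_eq_zero_of_simples k (fun S _ _ _ _ => ?_)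
    (isFiniteLength_iff_isNoetherian_isArtinian.2 ⟨inferInstance, inferInstance⟩)
  obtain ⟨T, hT, ⟨e⟩⟩ := h S
  rw [eulerPairing_congr k e, map_sub, hxy T hT, sub_self]

end Simples

/-! ### Cones of g-vectors and comparison of pairs -/

section SsPair

variable (k : Type u) [Field k] {Λ : Type v} [Ring Λ] [Algebra k Λ] [Module.Finite k Λ]

/-- The g-vectors `h` with `T̄_g ⊆ T̄_h` and `F̄_g ⊆ F̄_h`, as a submonoid. -/
def ssCone (g : KZeroProj Λ) : AddSubmonoid (KZeroProj Λ) where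
  carrier := {h | ssPair k g ≤ ssPair k h}
  zero_mem' := ⟨fun M _ N => by simp, fun M _ N => by simp⟩
  add_mem' := fun {a b} ha hb =>
    ⟨fun M hM N => by rw [map_add]; exact add_nonneg (ha.1 hM N) (hb.1 hM N),
      fun M hM N => by rw [map_add]; exact add_nonpos (ha.2 hM N) (hb.2 hM N)⟩

theorem mem_ssCone {g h : KZeroProj Λ} : h ∈ ssCone k g ↔ ssPair k g ≤ ssPair k h := Iff.rfl

theorem ssCone_le_ssCone {g h : KZeroProj Λ} (hgh : ssPair k g ≤ ssPair k h) :
    ssCone k h ≤ ssCone k g :=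
  fun _ hx => hgh.trans hx

variable {g h c : KZeroProj Λ} {n : ℕ} {M : Type v} [AddCommGroup M] [Module Λ M]
  [Module.Finite Λ M]

theorem of_mem_torsBar : FGModuleCat.of Λ M ∈ torsBar k g ↔
    ∀ N : Submodule Λ M, 0 ≤ eulerPairing k (M ⧸ N) g := Iff.rfl

theorem eulerPairing_nonneg_of_mem_torsBar (hM : FGModuleCat.of Λ M ∈ torsBar k g) :
    0 ≤ eulerPairing k M g := by
  have h := (of_mem_torsBar k).1 hM ⊥
  rwa [eulerPairing_congr k (Submodule.quotEquivOfEqBot ⊥ rfl)] at h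

variable [IsNoetherianRing Λ]

theorem of_mem_torfBar : FGModuleCat.of Λ M ∈ torfBar k g ↔
    ∀ N : Submodule Λ M, eulerPairing k N g ≤ 0 := Iff.rfl

theorem eulerPairing_nonpos_of_mem_torfBar (hM : FGModuleCat.of Λ M ∈ torfBar k g) :
    eulerPairing k M g ≤ 0 := by
  have h := (of_mem_torfBar k).1 hM ⊤
  rwa [eulerPairing_congr k Submodule.topEquiv] at h

/-- If `M` were not in `T̄_g`, its non-zero torsion-free quotient in `F̄_g` would pair negatively
with `g` and non-positively with `c`, hence negatively with `h`. -/
theorem of_mem_torsBar_of_eulerPairing (hn : 0 < n) (hc : torfBar k g ⊆ torfBar k c)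
    (hh : ∀ (M : Type v) [AddCommGroup M] [Module Λ M] [Module.Finite Λ M],
      eulerPairing k M h = n * eulerPairing k M g + eulerPairing k M c)
    (hM : FGModuleCat.of Λ M ∈ torsBar k h) : FGModuleCat.of Λ M ∈ torsBar k g := by
  rw [of_mem_torsBar] at hM ⊢
  obtain ⟨N, hN, hlt⟩ := exists_eulerPairing_submodule_max_largest k M g
  -- A submodule of `M ⧸ N` pairing positively with `g` would pull back to one beating `N`.
  have hF : FGModuleCat.of Λ (M ⧸ N) ∈ torfBar k g := (of_mem_torfBar k).2 fun L => by
    have h1 := eulerPairing_comap_mkQ k N L g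
    have h2 := hN (L.comap N.mkQ)
    linarith
  have hNtop : N = ⊤ := by
    by_contra hne
    have h1 := hlt ⊤ (lt_top_iff_ne_top.2 hne)
    have h2 := eulerPairing_submodule_add_quotient k N g
    rw [eulerPairing_congr k Submodule.topEquiv] at h1
    have h3 := eulerPairing_nonpos_of_mem_torfBar k (hc hF)
    have h4 := hM N
    rw [hh] at h4
    have h5 : (n : ℤ) * eulerPairing k (M ⧸ N) g < 0 :=
      mul_neg_of_pos_of_neg (by exact_mod_cast hn) (by linarith)
    linarith
  intro L
  have h1 := hN L
  have h2 := eulerPairing_submodule_add_quotient k L g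
  rw [hNtop, eulerPairing_congr k Submodule.topEquiv] at h1
  linarith

/-- Dual argument: the smallest maximizing submodule lies in `T̄_g`, and if non-zero it pairs
positively with `h`. -/
theorem of_mem_torfBar_of_eulerPairing [IsArtinianRing Λ] (hn : 0 < n)
    (hc : torsBar k g ⊆ torsBar k c)
    (hh : ∀ (M : Type v) [AddCommGroup M] [Module Λ M] [Module.Finite Λ M],
      eulerPairing k M h = n * eulerPairing k M g + eulerPairing k M c)
    (hM : FGModuleCat.of Λ M ∈ torfBar k h) : FGModuleCat.of Λ M ∈ torfBar k g := by
  rw [of_mem_torfBar] at hM ⊢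
  obtain ⟨N, hN, hlt⟩ := exists_eulerPairing_submodule_max_smallest k M g
  have hT : FGModuleCat.of Λ N ∈ torsBar k g := (of_mem_torsBar k).2 fun L => by
    have h1 := eulerPairing_submodule_add_quotient k L g
    have h2 := hN (L.map N.subtype)
    rw [eulerPairing_map_subtype] at h2
    linarith
  have hNbot : N = ⊥ := by
    by_contra hne
    have h1 := hlt ⊥ (bot_lt_iff_ne_bot.2 hne)
    rw [eulerPairing_of_subsingleton] at h1
    have h3 := eulerPairing_nonneg_of_mem_torsBar k (hc hT)
    have h4 := hM N
    rw [hh] at h4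
    have h5 : 0 < (n : ℤ) * eulerPairing k N g := mul_pos (by exact_mod_cast hn) h1
    linarith
  refine fun L => (hN L).trans ?_
  subst hNbot
  rw [eulerPairing_of_subsingleton]

/-- The relation between `h`, `g` and `c` is required only after pairing, since pairings are all
that the rational span controls. -/
theorem ssPair_le_of_eulerPairing [IsArtinianRing Λ] (hn : 0 < n) (hc : c ∈ ssCone k g)
    (hh : ∀ (M : Type v) [AddCommGroup M] [Module Λ M] [Module.Finite Λ M],
      eulerPairing k M h = n * eulerPairing k M g + eulerPairing k M c) :
    ssPair k h ≤ ssPair k g :=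
  ⟨fun _ hM => of_mem_torsBar_of_eulerPairing k hn hc.2 hh hM,
    fun _ hM => of_mem_torfBar_of_eulerPairing k hn hc.1 hh hM⟩

end SsPair

/-! ### Clearing denominators in the span of a cone -/

/-- A rational combination of elements of a monoid becomes a difference of two elements after
multiplication with a positive integer. -/
theorem AddSubmonoid.exists_nsmul_eq_sub_of_mem_span {G V : Type*} [AddCommGroup G]
    [AddCommGroup V] [Module ℚ V] (C : AddSubmonoid G) (f : G →+ V) {x : V}
    (hx : x ∈ Submodule.span ℚ (f '' C)) :
    ∃ n : ℕ, 0 < n ∧ ∃ a ∈ C, ∃ b ∈ C, n • x = f a - f b := by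
  induction hx using Submodule.span_induction with
  | mem x hx =>
    obtain ⟨a, ha, rfl⟩ := hx
    exact ⟨1, one_pos, a, ha, 0, C.zero_mem, by simp⟩
  | zero => exact ⟨1, one_pos, 0, C.zero_mem, 0, C.zero_mem, by simp⟩
  | add x y _ _ hx hy =>
    obtain ⟨n, hn, a, ha, b, hb, h1⟩ := hx
    obtain ⟨m, hm, c, hc, d, hd, h2⟩ := hy
    refine ⟨m * n, by positivity, m • a + n • c, C.add_mem (C.nsmul_mem ha _) (C.nsmul_mem hc _),
      m • b + n • d, C.add_mem (C.nsmul_mem hb _) (C.nsmul_mem hd _), ?_⟩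
    have h3 : (m * n) • (x + y) = m • (n • x) + n • (m • y) := by
      rw [smul_add, mul_smul, mul_comm m n, mul_smul]
    rw [h3, h1, h2]
    simp only [map_add, map_nsmul, smul_sub]
    abel
  | smul q x _ hx =>
    obtain ⟨n, hn, a, ha, b, hb, h1⟩ := hx
    have h2 : (q.den * n) • (q • x) = q.num • (n • x) := by
      rw [← Int.cast_smul_eq_zsmul ℚ q.num, ← Nat.cast_smul_eq_nsmul ℚ n,
        ← Nat.cast_smul_eq_nsmul ℚ (q.den * n), smul_smul, smul_smul]
      congr 1
      have := Rat.den_mul_eq_num q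
      push_cast
      linear_combination (n : ℚ) * this
    refine ⟨q.den * n, Nat.mul_pos q.den_pos hn, ?_⟩
    rw [h2, h1]
    -- A monoid admits only natural multiples; a negative numerator swaps `a` and `b`.
    obtain ⟨m, hm | hm⟩ := Int.eq_nat_or_neg q.num
    · exact ⟨m • a, C.nsmul_mem ha _, m • b, C.nsmul_mem hb _, by
        simp [hm, smul_sub]⟩
    · exact ⟨m • b, C.nsmul_mem hb _, m • a, C.nsmul_mem ha _, by
        simp [hm, smul_sub, neg_add_eq_sub]⟩

/-! ### Existence of minimal pairs -/

theorem mainTheorem9 (k : Type u) [Field k] [IsAlgClosed k]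
    (Λ : Type v) [Ring Λ] [Algebra k Λ] [Module.Finite k Λ]
    (S : Set (Set (FGModuleCat.{v} Λ) × Set (FGModuleCat.{v} Λ)))
    (hS : S ⊆ TFss k Λ) (hne : S.Nonempty) :
    ∃ p, Minimal (· ∈ S) p := by
  have : IsNoetherianRing Λ := isNoetherian_of_tower k inferInstance
  have : IsArtinianRing Λ := isArtinian_of_tower k inferInstance
  have hpair : ∀ p ∈ S, ∃ g, p = ssPair k g := fun p hp => by
    obtain ⟨_, ⟨g, rfl⟩, h, rfl, _⟩ := hS hp
    exact ⟨h, rfl⟩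
  obtain ⟨s, hs, hdet⟩ := exists_finite_eulerPairing k (Λ := Λ)
  have : Finite s := hs
  let ψ : KZeroProj Λ →+ (s → ℚ) :=
    AddMonoidHom.pi fun T => (Int.castAddHom ℚ).comp (eulerPairing k T.1)
  have hψ : ∀ x y, ψ x = ψ y →
      ∀ (M : Type v) [AddCommGroup M] [Module Λ M] [Module.Finite Λ M],
        eulerPairing k M x = eulerPairing k M y := fun x y hxy =>
    hdet x y fun T hT => Int.cast_injective (α := ℚ) (congrFun hxy ⟨T, hT⟩)
  let W : KZeroProj Λ → Submodule ℚ (s → ℚ) := fun g =>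
    Submodule.span ℚ (ψ '' (ssCone k g : Set (KZeroProj Λ)))
  -- choose a pair whose cone spans a subspace of maximal dimension
  obtain ⟨g, hg, hmax⟩ : ∃ g, ssPair k g ∈ S ∧
      ∀ h, ssPair k h ∈ S → finrank ℚ (W h) ≤ finrank ℚ (W g) := by
    obtain ⟨p, hp⟩ := hne
    obtain ⟨g₀, rfl⟩ := hpair p hp
    -- Maximal dimension is minimal codimension, a natural number.
    obtain ⟨g, hg, h⟩ := (InvImage.wf (fun g => finrank ℚ (s → ℚ) - finrank ℚ (W g))
      Nat.lt_wfRel.wf).has_min {g | ssPair k g ∈ S} ⟨g₀, hp⟩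
    refine ⟨g, hg, fun h' hh' => ?_⟩
    have h1 := h h' hh'
    have h2 := Submodule.finrank_le (W h')
    have h3 := Submodule.finrank_le (W g)
    change ¬(finrank ℚ (s → ℚ) - finrank ℚ (W h') < finrank ℚ (s → ℚ) - finrank ℚ (W g)) at h1
    omega
  refine ⟨ssPair k g, hg, fun p hp hle => ?_⟩
  obtain ⟨h, rfl⟩ := hpair p hp
  have hcone := ssCone_le_ssCone k hle
  have hW : W g = W h :=
    Submodule.eq_of_le_of_finrank_le (Submodule.span_mono (Set.image_mono hcone)) (hmax h hp)
  -- `h` lies in its own cone, hence in the common span.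
  have hmem : ψ h ∈ W g := hW ▸ Submodule.subset_span ⟨h, (mem_ssCone k).2 le_rfl, rfl⟩
  obtain ⟨n, hn, a, ha, b, hb, hab⟩ :=
    AddSubmonoid.exists_nsmul_eq_sub_of_mem_span (ssCone k g) ψ hmem
  have hgg : g ∈ ssCone k g := (mem_ssCone k).2 le_rfl
  have h1 : ssPair k g ≤ ssPair k (g + a) := (ssCone k g).add_mem hgg ha
  refine h1.trans (ssPair_le_of_eulerPairing k hn (hcone ((ssCone k g).add_mem hgg hb)) ?_)
  intro M _ _ _
  rw [hψ (g + a) (n • h + (g + b)) (by simp only [map_add, map_nsmul, hab]; abel)]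
  simp
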